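/- **Notation.** Let $q\in\mathbb N$, $\alpha\in\mathbb R$. Matrices are complex $q\times q$; $B\ge 0$ means that $B$ is Hermitian and nonnegative definite, $\ker B$ is its null space, and $B^{+}$ its Moore–Penrose inverse. For a sequence $(s_j)$ of matrices put $H_n(s)=(s_{j+k})_{j,k=0}^n$ (block Hankel matrix) and $s^{(\alpha)}_j=-\alpha s_j+s_{j+1}$. *Classes.* For $m\in\mathbb N_0$, $\mathcal K^{\ge}_{q,m,\alpha}$ is the set of all $(s_j)_{j=0}^m$ such that: $H_0(s)\ge0$ if $m=0$; $H_n(s)\ge 0$ and $H_{n-1}(s^{(\alpha)})\ge 0$ if $m=2n$, $n\ge1$; $H_n(s)\ge 0$ and $H_n(s^{(\alpha)})\ge0$ if $m=2n+1$. For $m\in\mathbb N_0$, $\mathcal K^{\ge,e}_{q,m,\alpha}$ is the set of all $(s_j)_{j=0}^m$ for which there is a matrix $s_{m+1}$ with $(s_j)_{j=0}^{m+1}\in\mathcal K^{\ge}_{q,m+1,\alpha}$; and $\mathcal K^{\ge,e}_{q,\infty,\alpha}$ is the set of all infinite sequences $(s_j)_{j=0}^\infty$ with $(s_j)_{j=0}^m\in\mathcal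 K^{\ge}_{q,m,\alpha}$ for all $m\in\mathbb N_0$. *Parametrization.* Let $L_0(s)=s_0$ and, for $n\ge1$, $$L_n(s)=s_{2n}-[s_n,\dots,s_{2n-1}]\,H_{n-1}(s)^{+}\begin{bmatrix}s_n\\ \vdots\\ s_{2n-1}\end{bmatrix}.$$ The right $\alpha$-Stieltjes parametrization of $(s_j)_{j=0}^\kappa$ is the sequence $(Q_j)_{j=0}^\kappa$ with $Q_{2k}=L_k(s)$ for $2k\le\kappa$ and $Q_{2k+1}=L_k(s^{(\alpha)})$ for $2k+1\le\kappa$. *Inverse transform.* For a sequence $(t_j)_{j=0}^\kappa$ and a matrix $A$, the inverse $\alpha$-Schur–Stieltjes transform of $[(t_j)_{j=0}^\kappa,A]$ is the sequence $(s_j)_{j=0}^{\kappa+1}$ given recursively by $s_0=A$ and $$s_j=\alpha^jA+\sum_{l=1}^{j}\alpha^{j-l}AA^{+}\Bigl[\sum_{k=0}^{l-1}t_{l-k-1}A^{+}(-\alpha s_{k-1}+s_k)\Bigr]\qquad(1\le j\le\kappa+1),\qquad s_{-1}:=0.$$ **Theorem.** Let $\alpha\in\mathbb R$ and let $A\ge0$.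 (a) Let $\kappa\in\mathbb N_0\cup\{\infty\}$ and let $(t_j)_{j=0}^\kappa\in\mathcal K^{\ge,e}_{q,\kappa,\alpha}$ with $\ker A\subseteq\ker t_0$. Let $(s_j)_{j=0}^{\kappa+1}$ be the inverse $\alpha$-Schur–Stieltjes transform of $[(t_j)_{j=0}^\kappa,A]$, and let $(T_j)_{j=0}^\kappa$ and $(Q_j)_{j=0}^{\kappa+1}$ be the right $\alpha$-Stieltjes parametrizations of $(t_j)_{j=0}^\kappa$ and $(s_j)_{j=0}^{\kappa+1}$. Then $Q_0=A$ and $Q_j=T_{j-1}$ for all integers $j$ with $1\le j\le\kappa+1$. (b) Let $m\in\mathbb N_0$ and let $(t_j)_{j=0}^m\in\mathcal K^{\ge}_{q,m,\alpha}$ with $\ker A\subseteq\ker t_0\cap\ker t_m$. Define $(s_j)_{j=0}^{m+1}$, $(T_j)_{j=0}^m$ and $(Q_j)_{j=0}^{m+1}$ from $(t_j)_{j=0}^m$ and $A$ as in (a), with $\kappa=m$. Then $Q_0=A$ and $Q_j=T_{j-1}$ for all $j\in\{1,\dots,m+1\}$. -/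

import Mathlib

open scoped ComplexOrder

namespace StieltjesSchur

section MoorePenrose

/-- `B` satisfies the four Penrose equations for `A`. -/
structure IsMoorePenrose {m n : Type*} [Fintype m] [Fintype n]
    (A : Matrix m n ℂ) (B : Matrix n m ℂ) : Prop where
  mul_mul_left : A * B * A = A
  mul_mul_right : B * A * B = B
  hermitian_left : (A * B).IsHermitian
  hermitian_right : (B * A).IsHermitian

theorem IsMoorePenrose.unique {m n : Type*} [Fintype m] [Fintype n]
    {A : Matrix m n ℂ} {B C : Matrix n m ℂ}
    (hB : IsMoorePenrose A B) (hC : IsMoorePenrose A C) : B = C := by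
  have h1 : A * B = A * C := by
    calc A * B = (A * C * A) * B := by rw [hC.mul_mul_left]
      _ = (A * C) * (A * B) := by rw [Matrix.mul_assoc]
      _ = (A * C).conjTranspose * (A * B).conjTranspose := by
          rw [hC.hermitian_left.eq, hB.hermitian_left.eq]
      _ = ((A * B * A) * C).conjTranspose := by
          rw [← Matrix.conjTranspose_mul]; simp only [Matrix.mul_assoc]
      _ = A * C := by rw [hB.mul_mul_left, hC.hermitian_left.eq]
  have h2 : B * A = C * A := by
    calc B * A = B * (A * C * A) := by rw [hC.mul_mul_left]
      _ = (B * A) * (C * A) := by simp only [Matrix.mul_assoc]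
      _ = (B * A).conjTranspose * (C * A).conjTranspose := by
          rw [hC.hermitian_right.eq, hB.hermitian_right.eq]
      _ = (C * (A * B * A)).conjTranspose := by
          rw [← Matrix.conjTranspose_mul]; simp only [Matrix.mul_assoc]
      _ = C * A := by rw [hB.mul_mul_left, hC.hermitian_right.eq]
  calc B = B * A * B := hB.mul_mul_right.symm
    _ = C * (A * B) := by rw [h2, Matrix.mul_assoc]
    _ = C * A * C := by rw [h1, Matrix.mul_assoc]
    _ = C := hC.mul_mul_right

theorem exists_isMoorePenrose {m n : Type*} [Fintype m] [Fintype n] (A : Matrix m n ℂ) :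
    ∃ B : Matrix n m ℂ, IsMoorePenrose A B := by
  classical
  have hS : (A.conjTranspose * A).IsHermitian := Matrix.isHermitian_conjTranspose_mul_self A
  set S := A.conjTranspose * A with hSdef
  obtain ⟨G, hGh, hSGS, hGSG, hc⟩ :
      ∃ G : Matrix n n ℂ, G.IsHermitian ∧ S * G * S = S ∧ G * S * G = G ∧ G * S = S * G := by
    set U : Matrix n n ℂ := (hS.eigenvectorUnitary : Matrix n n ℂ) with hU
    set d : n → ℂ := fun i => (hS.eigenvalues i : ℂ) with hd
    have hUU : star U * U = 1 := Unitary.coe_star_mul_self hS.eigenvectorUnitary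
    have hspec : S = U * Matrix.diagonal d * star U := by
      have h := hS.spectral_theorem
      rw [Unitary.conjStarAlgAut_apply] at h
      exact h
    have key : ∀ a b : n → ℂ, (U * Matrix.diagonal a * star U) * (U * Matrix.diagonal b * star U)
        = U * Matrix.diagonal (fun i => a i * b i) * star U := by
      intro a b
      calc _ = U * Matrix.diagonal a * (star U * U) * Matrix.diagonal b * star U := by
            simp only [Matrix.mul_assoc]
        _ = _ := by
            rw [hUU, Matrix.mul_one, Matrix.mul_assoc U, Matrix.diagonal_mul_diagonal]
    refine ⟨U * Matrix.diagonal (fun i => (d i)⁻¹) * star U, ?_, ?_, ?_, ?_⟩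
    · have : star (fun i => (d i)⁻¹) = fun i => (d i)⁻¹ := by
        funext i; simp [hd]
      rw [Matrix.IsHermitian, Matrix.conjTranspose_mul, Matrix.conjTranspose_mul,
        Matrix.diagonal_conjTranspose, this, Matrix.star_eq_conjTranspose,
        Matrix.conjTranspose_conjTranspose, Matrix.mul_assoc]
    · rw [hspec, key, key]
      congr 3; funext i
      exact mul_inv_mul_cancel (d i)
    · rw [hspec, key, key]
      congr 3; funext i
      by_cases h : d i = 0 <;> simp [h]
    · rw [hspec, key, key]
      congr 3; funext i
      exact mul_comm _ _
  have hA : A * (G * S) = A := by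
    have h0 : (A * (G * S) - A).conjTranspose * (A * (G * S) - A) = 0 := by
      have e : (A * (G * S)).conjTranspose = S * G * A.conjTranspose := by
        rw [Matrix.conjTranspose_mul, Matrix.conjTranspose_mul, hS.eq, hGh.eq]
      rw [Matrix.conjTranspose_sub, e, Matrix.sub_mul, Matrix.mul_sub, Matrix.mul_sub]
      have e1 : S * G * A.conjTranspose * (A * (G * S)) = S := by
        calc _ = S * G * S * (G * S) := by rw [hSdef]; simp only [Matrix.mul_assoc]
          _ = S := by rw [hSGS, ← Matrix.mul_assoc, hSGS]
      have e2 : S * G * A.conjTranspose * A = S := by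
        rw [Matrix.mul_assoc, ← hSdef, hSGS]
      have e3 : A.conjTranspose * (A * (G * S)) = S := by
        rw [← Matrix.mul_assoc, ← hSdef, ← Matrix.mul_assoc, hSGS]
      rw [e1, e2, e3, ← hSdef]; simp
    exact sub_eq_zero.1 (Matrix.conjTranspose_mul_self_eq_zero.1 h0)
  refine ⟨G * A.conjTranspose, ?_, ?_, ?_, ?_⟩
  · calc _ = A * (G * S) := by rw [hSdef]; simp only [Matrix.mul_assoc]
      _ = A := hA
  · calc _ = (G * S * G) * A.conjTranspose := by rw [hSdef]; simp only [Matrix.mul_assoc]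
      _ = _ := by rw [hGSG]
  · rw [Matrix.IsHermitian, Matrix.conjTranspose_mul, Matrix.conjTranspose_mul,
      Matrix.conjTranspose_conjTranspose, hGh.eq, Matrix.mul_assoc]
  · rw [Matrix.mul_assoc, ← hSdef, Matrix.IsHermitian, Matrix.conjTranspose_mul, hS.eq, hGh.eq, hc]

/-- The Moore-Penrose inverse `A⁺` of a complex matrix. -/
noncomputable def mpInv {m n : Type*} [Fintype m] [Fintype n] (A : Matrix m n ℂ) :
    Matrix n m ℂ :=
  (exists_isMoorePenrose A).choose

theorem isMoorePenrose_mpInv {m n : Type*} [Fintype m] [Fintype n] (A : Matrix m n ℂ) :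
    IsMoorePenrose A (mpInv A) :=
  (exists_isMoorePenrose A).choose_spec

end MoorePenrose

/- A sequence `(s_j)_{j=0}^κ` of complex `p × q` matrices is represented by a function
`s : ℕ → Matrix (Fin p) (Fin q) ℂ` of which only the values `s j` with `j ≤ κ` matter. -/

section Sequences

/-- The block Hankel matrix `H_n = (s_{j+k})_{j,k=0}^n`. -/
def hankel {p q : ℕ} (s : ℕ → Matrix (Fin p) (Fin q) ℂ) (n : ℕ) :
    Matrix (Fin (n + 1) × Fin p) (Fin (n + 1) × Fin q) ℂ :=
  Matrix.of fun a b => s (a.1 + b.1) a.2 b.2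

/-- The block column `col(s_l, …, s_{l+n})`. -/
def blockCol {p q : ℕ} (s : ℕ → Matrix (Fin p) (Fin q) ℂ) (l n : ℕ) :
    Matrix (Fin (n + 1) × Fin p) (Fin q) ℂ :=
  Matrix.of fun a b => s (l + a.1) a.2 b

/-- The block row `[s_l, …, s_{l+n}]`. -/
def blockRow {p q : ℕ} (s : ℕ → Matrix (Fin p) (Fin q) ℂ) (l n : ℕ) :
    Matrix (Fin p) (Fin (n + 1) × Fin q) ℂ :=
  Matrix.of fun a b => s (l + b.1) a b.2

/-- The right-sided `α`-shift `-α s_j + s_{j+1}`. -/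
def rightShift {p q : ℕ} (α : ℂ) (s : ℕ → Matrix (Fin p) (Fin q) ℂ) :
    ℕ → Matrix (Fin p) (Fin q) ℂ :=
  fun j => -(α • s j) + s (j + 1)

/-- The sequence `-α s_{j-1} + s_j` with the convention `s_{-1} = 0`. -/
def plusTransform {p q : ℕ} (α : ℂ) (s : ℕ → Matrix (Fin p) (Fin q) ℂ) :
    ℕ → Matrix (Fin p) (Fin q) ℂ
  | 0 => s 0
  | j + 1 => -(α • s j) + s (j + 1)

/-- The Schur complements `L_0 = s_0` and
`L_n = s_{2n} - [s_n, …, s_{2n-1}] (H_{n-1})⁺ col(s_n, …, s_{2n-1})` for `n ≥ 1`. -/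
noncomputable def schurL {p q : ℕ} (s : ℕ → Matrix (Fin p) (Fin q) ℂ) :
    ℕ → Matrix (Fin p) (Fin q) ℂ
  | 0 => s 0
  | n + 1 =>
      s (2 * (n + 1)) - blockRow s (n + 1) n * mpInv (hankel s n) * blockCol s (n + 1) n

/-- The right `α`-Stieltjes parametrization `(Q_j)` of `(s_j)`: `Q_{2k}` is the matrix `L_k` of
`(s_j)`, and `Q_{2k+1}` is the matrix `L_k` of `(-α s_j + s_{j+1})`. The matrix `Q_j` depends only
on `s_0, …, s_j`. -/
noncomputable def stieltjesParam {p q : ℕ} (α : ℂ) (s : ℕ → Matrix (Fin p) (Fin q) ℂ) (j : ℕ) :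
    Matrix (Fin p) (Fin q) ℂ :=
  if Even j then schurL s (j / 2) else schurL (rightShift α s) (j / 2)

theorem stieltjesParam_even {p q : ℕ} (α : ℂ) (s : ℕ → Matrix (Fin p) (Fin q) ℂ) (k : ℕ) :
    stieltjesParam α s (2 * k) = schurL s k := by
  simp [stieltjesParam]

theorem stieltjesParam_odd {p q : ℕ} (α : ℂ) (s : ℕ → Matrix (Fin p) (Fin q) ℂ) (k : ℕ) :
    stieltjesParam α s (2 * k + 1) = schurL (rightShift α s) k := by
  have : (2 * k + 1) / 2 = k := by omega
  simp [stieltjesParam, this]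

/-- The inverse `α`-Schur-Stieltjes transform of `[(t_j), A]`. The term of index `j` depends
only on `A` and `t_0, …, t_{j-1}`. The recursion in its customary indexing is
`invTransform_eq`. -/
noncomputable def invTransform {p q : ℕ} (α : ℂ) (t : ℕ → Matrix (Fin p) (Fin q) ℂ)
    (A : Matrix (Fin p) (Fin q) ℂ) : ℕ → Matrix (Fin p) (Fin q) ℂ
  | 0 => A
  | j + 1 => α ^ (j + 1) • A + ∑ l : Fin (j + 1), α ^ (j - l.1) • (A * mpInv A *
      ∑ k : Fin (l.1 + 1), t (l.1 - k.1) * mpInv A *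
        (if k.1 = 0 then invTransform α t A k.1
          else -(α • invTransform α t A (k.1 - 1)) + invTransform α t A k.1))
  decreasing_by all_goals (have := l.2; have := k.2; omega)

theorem invTransform_zero {p q : ℕ} (α : ℂ) (t : ℕ → Matrix (Fin p) (Fin q) ℂ)
    (A : Matrix (Fin p) (Fin q) ℂ) : invTransform α t A 0 = A := by
  rw [invTransform]

theorem invTransform_eq {p q : ℕ} (α : ℂ) (t : ℕ → Matrix (Fin p) (Fin q) ℂ)
    (A : Matrix (Fin p) (Fin q) ℂ) (j : ℕ) (hj : 1 ≤ j) :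
    invTransform α t A j = α ^ j • A + ∑ l ∈ Finset.Icc 1 j, α ^ (j - l) • (A * mpInv A *
      ∑ k ∈ Finset.range l,
        t (l - k - 1) * mpInv A * plusTransform α (invTransform α t A) k) := by
  obtain ⟨j, rfl⟩ : ∃ i, j = i + 1 := ⟨j - 1, by omega⟩
  rw [invTransform]
  congr 1
  rw [Fin.sum_univ_eq_sum_range (fun l => α ^ (j - l) • (A * mpInv A *
      ∑ k : Fin (l + 1), t (l - k.1) * mpInv A *
        (if k.1 = 0 then invTransform α t A k.1
          else -(α • invTransform α t A (k.1 - 1)) + invTransform α t A k.1))) (j + 1),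
    Finset.range_eq_Ico, ← Finset.Ico_add_one_right_eq_Icc,
    Finset.sum_Ico_eq_sum_range _ 1 (j + 1 + 1), ← Finset.range_eq_Ico]
  refine Finset.sum_congr rfl fun l hl => ?_
  have e : j + 1 - (1 + l) = j - l := by omega
  rw [e, Fin.sum_univ_eq_sum_range (fun k => t (l - k) * mpInv A *
        (if k = 0 then invTransform α t A k
          else -(α • invTransform α t A (k - 1)) + invTransform α t A k)) (l + 1), add_comm 1 l]
  refine congrArg _ (congrArg _ (Finset.sum_congr rfl fun k hk => ?_))
  have e : l + 1 - k - 1 = l - k := by omega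
  rw [e]
  cases k <;> simp [plusTransform]

/-- The class `K^≥_{q,m,α}` of `α`-Stieltjes-nonnegative definite sequences `(s_j)_{j=0}^m`,
`m` finite: with `H_n` built from `(s_j)` and `H^α_n` built from `(-α s_j + s_{j+1})`, this asks
for `H_0 ≥ 0` if `m = 0`, for `H_n ≥ 0` and `H^α_{n-1} ≥ 0` if `m = 2n` with `n ≥ 1`, and for
`H_n ≥ 0` and `H^α_n ≥ 0` if `m = 2n + 1`. -/
def IsStieltjesNonneg {q : ℕ} (α : ℝ) (m : ℕ) (s : ℕ → Matrix (Fin q) (Fin q) ℂ) : Prop :=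
  (hankel s (m / 2)).PosSemidef ∧
    (1 ≤ m → (hankel (rightShift (α : ℂ) s) ((m - 1) / 2)).PosSemidef)

theorem isStieltjesNonneg_zero {q : ℕ} (α : ℝ) (s : ℕ → Matrix (Fin q) (Fin q) ℂ) :
    IsStieltjesNonneg α 0 s ↔ (hankel s 0).PosSemidef := by
  simp [IsStieltjesNonneg]

theorem isStieltjesNonneg_even {q : ℕ} (α : ℝ) (s : ℕ → Matrix (Fin q) (Fin q) ℂ) (n : ℕ) :
    IsStieltjesNonneg α (2 * (n + 1)) s ↔
      (hankel s (n + 1)).PosSemidef ∧ (hankel (rightShift (α : ℂ) s) n).PosSemidef := by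
  have h : (2 * (n + 1) - 1) / 2 = n := by omega
  have h' : 1 ≤ 2 * (n + 1) := by omega
  have h'' : 2 * (n + 1) / 2 = n + 1 := by omega
  rw [IsStieltjesNonneg, h, h'']
  simp only [h', true_imp_iff]

theorem isStieltjesNonneg_odd {q : ℕ} (α : ℝ) (s : ℕ → Matrix (Fin q) (Fin q) ℂ) (n : ℕ) :
    IsStieltjesNonneg α (2 * n + 1) s ↔
      (hankel s n).PosSemidef ∧ (hankel (rightShift (α : ℂ) s) n).PosSemidef := by
  have h : (2 * n + 1) / 2 = n := by omega
  have h' : (2 * n + 1 - 1) / 2 = n := by omega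
  have h'' : 1 ≤ 2 * n + 1 := by omega
  rw [IsStieltjesNonneg, h, h']
  simp only [h'', true_imp_iff]

/-- The class `K^{≥,e}_{q,κ,α}`, `κ ∈ ℕ₀ ∪ {∞}`, of `α`-Stieltjes-nonnegative definite extendable
sequences: for finite `κ = m`, some choice of a further matrix `s_{m+1}` gives a sequence in
`K^≥_{q,m+1,α}`; for `κ = ∞`, all finite sections are in `K^≥_{q,m,α}`. -/
def IsStieltjesNonnegExt {q : ℕ} (α : ℝ) (κ : ℕ∞) (s : ℕ → Matrix (Fin q) (Fin q) ℂ) : Prop :=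
  match κ with
  | (m : ℕ) => ∃ X : Matrix (Fin q) (Fin q) ℂ,
      IsStieltjesNonneg α (m + 1) (Function.update s (m + 1) X)
  | ⊤ => ∀ m : ℕ, IsStieltjesNonneg α m s

theorem isStieltjesNonnegExt_coe {q : ℕ} (α : ℝ) (m : ℕ) (s : ℕ → Matrix (Fin q) (Fin q) ℂ) :
    IsStieltjesNonnegExt α (m : ℕ∞) s ↔ ∃ X : Matrix (Fin q) (Fin q) ℂ,
      IsStieltjesNonneg α (m + 1) (Function.update s (m + 1) X) :=
  Iff.rfl

theorem isStieltjesNonnegExt_top {q : ℕ} (α : ℝ) (s : ℕ → Matrix (Fin q) (Fin q) ℂ) :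
    IsStieltjesNonnegExt α ⊤ s ↔ ∀ m : ℕ, IsStieltjesNonneg α m s :=
  Iff.rfl

end Sequences

end StieltjesSchur

/-!
The matrix `L_n(s)` is the leading error coefficient of the right `[n-1/n]` Padé approximation of
`S = ∑ s_j X^j`. Let `T = ∑ t_j X^j` and `B = A⁺`. The inverse transform is defined so that
`P = (1 - αX) S` solves `P = A + X T B P`, equivalently `P = A + X P B T`. Writing
`P = A + X P'` with `P' = ∑ s^(α)_j X^j` gives `P' = T + X P' B T`, and this fractional linear
change of `T` multiplies the Padé errors on the left by `1 + X P' B`, so that their leading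
coefficients persist: `L_n(s^(α)) = L_n(t)`. Expressing `T` through `τ = ∑ t^(α)_j X^j` gives
`S = A + X S (α + B t_0) + X² S B τ`, one step of a continued fraction: it shifts the index of the
Padé errors by one and multiplies them on the left by `S B`, whose constant coefficient `A A⁺`
fixes them. Hence `L_{n+1}(s) = L_n(t^(α))`.
-/

namespace StieltjesSchur

section Pade

open PowerSeries Finset.HasAntidiagonal

variable {R : Type*} [Ring R]

/-- `L` is the leading error coefficient of a right Padé approximation of type `[n-1/n]` to `S`:
`S V = W + L X^{2n} + O(X^{2n+1})`, where `V` and `W` are polynomials (encoded as power series with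
vanishing higher coefficients) with `deg V ≤ n`, `V(0) = 1` and `deg W < n`. For a Hermitian
sequence `s` with nonnegative definite block Hankel matrix `H_n`, the matrix `L_n` is the
`L` belonging to `S = ∑ s_j X^j`. -/
def HasPadeRemainder (S : R⟦X⟧) (n : ℕ) (L : R) : Prop :=
  ∃ V W D : R⟦X⟧, constantCoeff V = 1 ∧ (∀ k > n, coeff k V = 0) ∧ (∀ k ≥ n, coeff k W = 0) ∧
    constantCoeff D = L ∧ S * V = W + X ^ (2 * n) * D

theorem hasPadeRemainder_iff_coeff {S : R⟦X⟧} {n : ℕ} {L : R} :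
    HasPadeRemainder S n L ↔ ∃ V : R⟦X⟧, constantCoeff V = 1 ∧ (∀ k > n, coeff k V = 0) ∧
      (∀ j < n, coeff (n + j) (S * V) = 0) ∧ coeff (2 * n) (S * V) = L := by
  constructor
  · rintro ⟨V, W, D, hV0, hV, hW, rfl, hSV⟩
    refine ⟨V, hV0, hV, fun j hj => ?_, ?_⟩
    · rw [hSV, map_add, hW _ (by omega), coeff_X_pow_mul', if_neg (by omega), add_zero]
    · rw [hSV, map_add, hW _ (by omega), coeff_X_pow_mul', if_pos le_rfl, zero_add, Nat.sub_self,
        coeff_zero_eq_constantCoeff_apply]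
  · rintro ⟨V, hV0, hV, hgap, hL⟩
    refine ⟨V, trunc (2 * n) (S * V), mk fun k => coeff (k + 2 * n) (S * V), hV0, hV,
      fun k hk => ?_, ?_, ?_⟩
    · rw [Polynomial.coeff_coe, coeff_trunc]
      split_ifs with hk'
      · obtain ⟨j, rfl⟩ := Nat.exists_eq_add_of_le hk
        exact hgap j (by omega)
      · rfl
    · simpa [← coeff_zero_eq_constantCoeff_apply] using hL
    · rw [add_comm]
      exact eq_X_pow_mul_shift_add_trunc (2 * n) (S * V)

theorem hasPadeRemainder_zero_iff {S : R⟦X⟧} {L : R} :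
    HasPadeRemainder S 0 L ↔ constantCoeff S = L := by
  rw [hasPadeRemainder_iff_coeff]
  constructor
  · rintro ⟨V, hV0, -, -, hL⟩
    simpa [hV0] using hL
  · rintro rfl
    exact ⟨1, map_one _, fun k hk => by simp [coeff_one, Nat.ne_of_gt hk], by simp, by simp⟩

theorem HasPadeRemainder.mul_eq_self {S : R⟦X⟧} {n : ℕ} {E L : R} (h : HasPadeRemainder S n L)
    (hE : C E * S = S) : E * L = L := by
  obtain ⟨V, -, -, -, rfl⟩ := hasPadeRemainder_iff_coeff.1 h
  rw [← coeff_C_mul, ← mul_assoc, hE]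

theorem mul_X_mul (f g : R⟦X⟧) : f * (X * g) = X * (f * g) :=
  (commute_X f).left_comm g

theorem HasPadeRemainder.of_resolvent {S T : R⟦X⟧} {B L : R} {n : ℕ}
    (hS : S = T + X * (S * C B * T)) (hT : HasPadeRemainder T n L) :
    HasPadeRemainder S n L := by
  obtain ⟨V, W, D, hV0, hV, hW, rfl, hTV⟩ := hT
  -- The error of `T` is carried over to the denominator `V - X B W` and the numerator `W`.
  refine ⟨V - X * (C B * W), W, D + X * (S * C B * D), by simp [hV0], fun k hk => ?_, hW,
    by simp, ?_⟩
  · obtain ⟨k, rfl⟩ := Nat.exists_eq_add_of_lt hk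
    rw [map_sub, hV _ hk, coeff_succ_X_mul, coeff_C_mul, hW _ (by omega), mul_zero, sub_zero]
  · have hSV : S * V = T * V + X * (S * C B * (T * V)) := by
      conv_lhs => rw [hS]
      simp only [add_mul, mul_assoc]
    calc S * (V - X * (C B * W))
        = T * V + X * (S * C B * (T * V)) - X * (S * C B * W) := by
          rw [mul_sub, hSV, mul_X_mul, mul_assoc S (C B) W]
      _ = W + X ^ (2 * n) * D + X * (S * C B * (X ^ (2 * n) * D)) := by
          rw [hTV, mul_add (S * C B), mul_add X]; abel
      _ = W + X ^ (2 * n) * (D + X * (S * C B * D)) := by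
          rw [(commute_X_pow (S * C B) (2 * n)).left_comm, ← mul_assoc X, X_mul, mul_assoc,
            mul_add, add_assoc]

theorem HasPadeRemainder.succ_of_resolvent {S T : R⟦X⟧} {A B G L : R} {n : ℕ}
    (hS : S = C A + X * (S * C G) + X ^ 2 * (S * C B * T)) (hAB : C (A * B) * T = T)
    (hT : HasPadeRemainder T n L) : HasPadeRemainder S (n + 1) L := by
  have hL : A * B * L = L := hT.mul_eq_self hAB
  have hS0 : constantCoeff S = A := by rw [hS]; simp
  obtain ⟨V, W, D, hV0, hV, hW, rfl, hTV⟩ := hT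
  -- The denominator `V - X G V - X² B W` and the numerator `A V` raise the error order by two.
  refine ⟨V - X * (C G * V) - X ^ 2 * (C B * W), C A * V, S * C B * D, by simp [hV0],
    fun k hk => ?_, fun k hk => by rw [coeff_C_mul, hV k hk, mul_zero], by simp [hS0, hL], ?_⟩
  · obtain ⟨k, rfl⟩ : ∃ i, k = i + 1 + 1 := ⟨k - 2, by omega⟩
    rw [map_sub, map_sub, hV _ (by omega), coeff_succ_X_mul, coeff_C_mul, hV _ (by omega),
      add_assoc, coeff_X_pow_mul, coeff_C_mul, hW _ (by omega)]
    simp only [mul_zero, sub_zero]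
  · have hSV : S * V = C A * V + X * (S * (C G * V)) + X ^ 2 * (S * C B * (T * V)) := by
      conv_lhs => rw [hS]
      simp only [add_mul, mul_assoc]
    calc S * (V - X * (C G * V) - X ^ 2 * (C B * W))
        = C A * V + X ^ 2 * (S * C B * (T * V)) - X ^ 2 * (S * C B * W) := by
          rw [mul_sub, mul_sub, hSV, mul_X_mul, (commute_X_pow S 2).left_comm,
            mul_assoc S (C B) W]
          abel
      _ = C A * V + X ^ 2 * (S * C B * (X ^ (2 * n) * D)) := by
          rw [hTV, mul_add (S * C B), mul_add (X ^ 2)]; abel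
      _ = C A * V + X ^ (2 * (n + 1)) * (S * C B * D) := by
          rw [(commute_X_pow (S * C B) (2 * n)).left_comm, ← mul_assoc (X ^ 2), ← pow_add,
            show 2 + 2 * n = 2 * (n + 1) by ring]

theorem eq_of_sub_X_mul_resolvent {k : Type*} [CommRing k] [Algebra k R] {c : k} {S T T' : R⟦X⟧}
    {A B T₀ : R} (hT : X * T' = T - X * (c • T) - C T₀)
    (hS : S - X * (c • S) = C A + X * ((S - X * (c • S)) * C B * T)) :
    S = C A + X * (S * C (c • 1 + B * T₀)) + X ^ 2 * (S * C B * T') := by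
  have hc : S * C (c • 1) = c • S := by
    ext1 k
    simp [coeff_mul_C]
  have hTX : X ^ 2 * (S * C B * T') = X * (S * C B * (T - X * (c • T) - C T₀)) := by
    rw [← hT, mul_X_mul (S * C B), ← mul_assoc X X, ← sq]
  have hST : (S - X * (c • S)) * C B * T = S * C B * T - S * C B * (X * (c • T)) := by
    rw [mul_X_mul (S * C B), mul_smul_comm]
    simp only [sub_mul, mul_assoc, smul_mul_assoc]
    rw [mul_smul_comm, mul_smul_comm, mul_smul_comm]
  calc S = C A + X * (S * C B * T - S * C B * (X * (c • T))) + X * (c • S) := by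
        rw [← hST, ← hS, sub_add_cancel]
    _ = C A + X * (S * C (c • 1 + B * T₀)) + X ^ 2 * (S * C B * T') := by
        rw [hTX, map_add, mul_add S, hc, map_mul, ← mul_assoc S]
        simp only [mul_add, mul_sub]
        abel

theorem resolvent_of_eq_C_add_X_mul {P P' T : R⟦X⟧} {A B : R} (hP' : P = C A + X * P')
    (hP : P = C A + X * (P * C B * T)) (hAB : C (A * B) * T = T) :
    P' = T + X * (P' * C B * T) := by
  rw [map_mul] at hAB
  calc P' = P * C B * T := X_mul_cancel (add_left_cancel (hP'.symm.trans hP))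
    _ = T + X * (P' * C B * T) := by
      rw [hP']
      simp only [add_mul, hAB, mul_assoc]

theorem eq_zero_of_eq_X_mul_mul {F G : R⟦X⟧} (h : F = X * (G * F)) : F = 0 := by
  have hunit : IsUnit (1 - X * G) := isUnit_iff_constantCoeff.2 (by simp)
  rw [← hunit.mul_right_eq_zero, sub_mul, one_mul, mul_assoc, ← h, sub_self]

theorem resolvent_right_of_left {P T : R⟦X⟧} {A B : R} (hP : P = C A + X * (T * C B * P))
    (hAB : C (A * B) * T = T) (hBA : T * C (B * A) = T) : P = C A + X * (P * C B * T) := by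
  rw [map_mul] at hAB hBA
  refine sub_eq_zero.1 (eq_zero_of_eq_X_mul_mul (G := T * C B) ?_)
  have hA : T * C B * C A = T := by rw [mul_assoc, hBA]
  have hPT : X * (T * C B * (P * C B * T)) = P * C B * T - T := by
    have h : P * C B * T = T + X * (T * C B * (P * C B * T)) := by
      conv_lhs => rw [hP]
      simp only [add_mul, hAB, mul_assoc]
    exact eq_sub_of_add_eq' h.symm
  calc P - (C A + X * (P * C B * T)) = X * (T * C B * P) - X * (P * C B * T) := by
        nth_rewrite 1 [hP]; abel
    _ = X * (T * C B * P) - X * (T * C B * C A) - X * (X * (T * C B * (P * C B * T))) := by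
        rw [hA, hPT, mul_sub]; abel
    _ = X * (T * C B * (P - (C A + X * (P * C B * T)))) := by
        rw [mul_sub (T * C B), mul_add (T * C B), mul_X_mul (T * C B), mul_sub X, mul_add X,
          sub_sub]

theorem isSelfAdjoint_coeff_of_resolvent [StarRing R] {P T : R⟦X⟧} {A B : R}
    (hl : P = C A + X * (T * C B * P)) (hr : P = C A + X * (P * C B * T))
    (hA : IsSelfAdjoint A) (hB : IsSelfAdjoint B) (hT : ∀ k, IsSelfAdjoint (coeff k T)) (k : ℕ) :
    IsSelfAdjoint (coeff k P) := by
  induction k using Nat.strong_induction_on with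
  | _ k ih =>
    cases k with
    | zero => rw [hl]; simpa using hA
    | succ k =>
      have hl' : coeff (k + 1) P = ∑ ij ∈ antidiagonal k,
          coeff ij.1 T * B * coeff ij.2 P := by
        conv_lhs => rw [hl]
        simp [coeff_succ_C, coeff_succ_X_mul, coeff_mul _ _ P, coeff_mul_C]
      have hr' : coeff (k + 1) P = ∑ ij ∈ antidiagonal k,
          coeff ij.1 P * B * coeff ij.2 T := by
        conv_lhs => rw [hr]
        simp [coeff_succ_C, coeff_succ_X_mul, coeff_mul _ _ T, coeff_mul_C]
      calc star (coeff (k + 1) P)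
          = ∑ ij ∈ antidiagonal k, coeff ij.2 P * B * coeff ij.1 T := by
            rw [hl', star_sum]
            refine Finset.sum_congr rfl fun ij hij => ?_
            have hk := mem_antidiagonal.1 hij
            rw [star_mul, star_mul, (hT _).star_eq, hB.star_eq,
              (ih _ (by omega)).star_eq, mul_assoc]
        _ = coeff (k + 1) P := by
            rw [hr', ← Finset.Nat.sum_antidiagonal_swap]
            rfl

end Pade

section Kernel

open Matrix

variable {m n : Type*} [Fintype m] [Fintype n]

theorem mul_mpInv_mul_of_ker_le {A : Matrix m n ℂ} {k : Type*} {T : Matrix k n ℂ}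
    (h : LinearMap.ker A.mulVecLin ≤ LinearMap.ker T.mulVecLin) : T * (mpInv A * A) = T := by
  classical
  have hker : ∀ v, T *ᵥ (v - (mpInv A * A) *ᵥ v) = 0 := fun v => h <| by
    rw [LinearMap.mem_ker, mulVecLin_apply, mulVec_sub, mulVec_mulVec, ← Matrix.mul_assoc,
      (isMoorePenrose_mpInv A).mul_mul_left, sub_self]
  refine ext_of_mulVec_single fun i => ?_
  have := hker (Pi.single i 1)
  rwa [mulVec_sub, mulVec_mulVec, sub_eq_zero, eq_comm] at this

theorem mpInv_conjTranspose (A : Matrix m n ℂ) : mpInv Aᴴ = (mpInv A)ᴴ := by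
  have h := isMoorePenrose_mpInv A
  refine (isMoorePenrose_mpInv Aᴴ).unique ⟨?_, ?_, ?_, ?_⟩
  · rw [← conjTranspose_mul, ← conjTranspose_mul, ← Matrix.mul_assoc, h.mul_mul_left]
  · rw [← conjTranspose_mul, ← conjTranspose_mul, ← Matrix.mul_assoc, h.mul_mul_right]
  · rw [← conjTranspose_mul]
    exact h.hermitian_right.conjTranspose
  · rw [← conjTranspose_mul]
    exact h.hermitian_left.conjTranspose

theorem mpInv_isHermitian {A : Matrix n n ℂ} (hA : A.IsHermitian) : (mpInv A).IsHermitian := by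
  rw [IsHermitian, ← mpInv_conjTranspose, hA.eq]

theorem mul_mpInv_mul_of_ker_le_conjTranspose {A : Matrix n n ℂ} (hA : A.IsHermitian)
    {k : Type*} {T : Matrix n k ℂ} (h : LinearMap.ker A.mulVecLin ≤ LinearMap.ker Tᴴ.mulVecLin) :
    A * mpInv A * T = T := by
  have := congrArg conjTranspose (mul_mpInv_mul_of_ker_le h)
  rwa [conjTranspose_mul, conjTranspose_mul, conjTranspose_conjTranspose, hA.eq,
    (mpInv_isHermitian hA).eq] at this

theorem mul_mpInv_mul_eq_of_mul_eq {k l : Type*} {A : Matrix m n ℂ} {Z : Matrix k m ℂ}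
    {C : Matrix k n ℂ} {Y : Matrix n l ℂ} {B : Matrix m l ℂ} (hC : Z * A = C) (hB : A * Y = B) :
    C * mpInv A * B = C * Y := by
  rw [← hC, ← hB, ← Matrix.mul_assoc, Matrix.mul_assoc Z, Matrix.mul_assoc Z,
    (isMoorePenrose_mpInv A).mul_mul_left]

open scoped MatrixOrder in
theorem ker_submatrix_le_of_posSemidef {k l : Type*} [Finite l] {A : Matrix l l ℂ}
    (hA : A.PosSemidef) (e : m → l) (f : k → l) :
    LinearMap.ker (A.submatrix e e).mulVecLin ≤ LinearMap.ker (A.submatrix f e).mulVecLin := by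
  classical
  have := Fintype.ofFinite l
  obtain ⟨B, rfl⟩ := CStarAlgebra.nonneg_iff_eq_star_mul_self.1 hA.nonneg
  rw [star_eq_conjTranspose]
  intro v hv
  have hBv : B.submatrix id e *ᵥ v = 0 := by
    rw [← conjTranspose_mul_self_mulVec_eq_zero]
    exact hv
  calc (Bᴴ * B).submatrix f e *ᵥ v = Bᴴ.submatrix f id *ᵥ (B.submatrix id e *ᵥ v) := by
        rw [mulVec_mulVec]; rfl
    _ = 0 := by rw [hBv, mulVec_zero]

end Kernel

section Hankel

open Matrix PowerSeries

variable {q n : ℕ} {s : ℕ → Matrix (Fin q) (Fin q) ℂ}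

theorem blockRow_mul_blockCol (s x : ℕ → Matrix (Fin q) (Fin q) ℂ) (j l n : ℕ) :
    blockRow s j n * blockCol x l n = ∑ a ∈ Finset.range (n + 1), s (j + a) * x (l + a) := by
  rw [← Fin.sum_univ_eq_sum_range (fun a => s (j + a) * x (l + a))]
  ext i k
  simp only [mul_apply, Matrix.sum_apply, Fintype.sum_prod_type, blockRow, blockCol, of_apply]

theorem hankel_mul_eq_blockCol_iff {Y : Matrix (Fin (n + 1) × Fin q) (Fin q) ℂ} {l : ℕ} :
    hankel s n * Y = blockCol s l n ↔ ∀ j < n + 1, blockRow s j n * Y = s (l + j) := by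
  constructor
  · intro h j hj
    ext i k
    exact congrFun (congrFun h (⟨j, hj⟩, i)) k
  · intro h
    ext ⟨a, i⟩ k
    exact congrFun (congrFun (h a a.2) i) k

theorem coeff_mk_mul_of_constantCoeff_eq_one {V : (Matrix (Fin q) (Fin q) ℂ)⟦X⟧}
    (hV0 : constantCoeff V = 1) (hV : ∀ k > n + 1, coeff k V = 0) (j : ℕ) :
    coeff (n + 1 + j) (mk s * V) =
      s (n + 1 + j) + blockRow s j n * blockCol (fun a => coeff (n + 1 - a) V) 0 n := by
  have hlow : ∑ a ∈ Finset.range j, s a * coeff (n + 1 + j - a) V = 0 :=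
    Finset.sum_eq_zero fun a ha => by
      have := Finset.mem_range.1 ha
      rw [hV _ (by omega), mul_zero]
  have hshift : ∀ a, n + 1 + j - (j + a) = n + 1 - (0 + a) := fun a => by omega
  rw [coeff_mul, Finset.Nat.sum_antidiagonal_eq_sum_range_succ (fun a b => coeff a (mk s) *
    coeff b V), blockRow_mul_blockCol, Nat.succ_eq_add_one,
    show n + 1 + j + 1 = j + (n + 1 + 1) by ring]
  simp only [coeff_mk]
  rw [Finset.sum_range_add, hlow, zero_add, Finset.sum_range_succ, add_comm]
  simp only [hshift]
  rw [zero_add, Nat.sub_self, coeff_zero_eq_constantCoeff_apply, hV0, mul_one, add_comm j]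

theorem exists_blockCol_coeff_eq (Y : Matrix (Fin (n + 1) × Fin q) (Fin q) ℂ) :
    ∃ V : (Matrix (Fin q) (Fin q) ℂ)⟦X⟧, constantCoeff V = 1 ∧ (∀ k > n + 1, coeff k V = 0) ∧
      blockCol (fun a => coeff (n + 1 - a) V) 0 n = Y := by
  refine ⟨mk fun k => if k = 0 then 1 else if k ≤ n + 1 then
    Matrix.of fun i b => Y (Fin.ofNat (n + 1) (n + 1 - k), i) b else 0, ?_, fun k hk => ?_, ?_⟩
  · rw [← coeff_zero_eq_constantCoeff_apply, coeff_mk, if_pos rfl]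
  · rw [coeff_mk, if_neg (by omega), if_neg (by omega)]
  · ext ⟨a, i⟩ b
    have ha : n + 1 - (n + 1 - (a : ℕ)) = a := by omega
    rw [blockCol, of_apply, zero_add, coeff_mk, if_neg (by omega), if_pos (by omega), of_apply, ha,
      Fin.ofNat_val_eq_self]

theorem hasPadeRemainder_succ_iff {L : Matrix (Fin q) (Fin q) ℂ} :
    HasPadeRemainder (mk s) (n + 1) L ↔
      ∃ Y : Matrix (Fin (n + 1) × Fin q) (Fin q) ℂ, hankel s n * Y = blockCol s (n + 1) n ∧
        s (2 * (n + 1)) - blockRow s (n + 1) n * Y = L := by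
  simp only [hasPadeRemainder_iff_coeff, hankel_mul_eq_blockCol_iff, two_mul (n + 1)]
  constructor
  · rintro ⟨V, hV0, hV, hgap, rfl⟩
    refine ⟨-blockCol (fun a => coeff (n + 1 - a) V) 0 n, fun j hj => ?_, ?_⟩
    · rw [Matrix.mul_neg, neg_eq_iff_add_eq_zero, add_comm, ← hgap j hj,
        coeff_mk_mul_of_constantCoeff_eq_one hV0 hV]
    · rw [Matrix.mul_neg, sub_neg_eq_add, coeff_mk_mul_of_constantCoeff_eq_one hV0 hV]
  · rintro ⟨Y, hY, rfl⟩
    obtain ⟨V, hV0, hV, hVY⟩ := exists_blockCol_coeff_eq (-Y)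
    refine ⟨V, hV0, hV, fun j hj => ?_, ?_⟩
    · rw [coeff_mk_mul_of_constantCoeff_eq_one hV0 hV, hVY, Matrix.mul_neg, hY j hj,
        add_neg_cancel]
    · rw [coeff_mk_mul_of_constantCoeff_eq_one hV0 hV, hVY, Matrix.mul_neg, sub_eq_add_neg]

theorem hankel_isHermitian (hs : ∀ j, (s j).IsHermitian) (n : ℕ) : (hankel s n).IsHermitian := by
  ext ⟨a, i⟩ ⟨b, j⟩
  simpa only [hankel, conjTranspose_apply, of_apply, add_comm (b : ℕ)] using (hs (a + b)).apply i j

theorem conjTranspose_blockCol (hs : ∀ j, (s j).IsHermitian) (l n : ℕ) :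
    (blockCol s l n)ᴴ = blockRow s l n := by
  ext i ⟨a, j⟩
  exact (hs (l + a)).apply i j

theorem schurL_eq_of_hasPadeRemainder {L : Matrix (Fin q) (Fin q) ℂ}
    (hs : ∀ j, (s j).IsHermitian) (h : HasPadeRemainder (mk s) n L) : schurL s n = L := by
  cases n with
  | zero => simpa [schurL, ← coeff_zero_eq_constantCoeff_apply] using hasPadeRemainder_zero_iff.1 h
  | succ n =>
    obtain ⟨Y, hY, rfl⟩ := hasPadeRemainder_succ_iff.1 h
    have hY' : Yᴴ * hankel s n = blockRow s (n + 1) n := by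
      rw [← conjTranspose_blockCol hs, ← hY, conjTranspose_mul, (hankel_isHermitian hs n).eq]
    rw [schurL, mul_mpInv_mul_eq_of_mul_eq hY' hY]

theorem ker_hankel_le_ker_blockRow (h : (hankel s (n + 1)).PosSemidef) :
    LinearMap.ker (hankel s n).mulVecLin ≤ LinearMap.ker (blockRow s (n + 1) n).mulVecLin :=
  ker_submatrix_le_of_posSemidef h (Prod.map Fin.castSucc id) (Prod.mk (Fin.last (n + 1)))

theorem hasPadeRemainder_schurL (hs : ∀ j, (s j).IsHermitian) (h : (hankel s n).PosSemidef) :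
    HasPadeRemainder (mk s) n (schurL s n) := by
  cases n with
  | zero => rw [hasPadeRemainder_zero_iff, schurL, ← coeff_zero_eq_constantCoeff_apply, coeff_mk]
  | succ n =>
    refine hasPadeRemainder_succ_iff.2 ⟨mpInv (hankel s n) * blockCol s (n + 1) n, ?_, ?_⟩
    · rw [← Matrix.mul_assoc]
      refine mul_mpInv_mul_of_ker_le_conjTranspose (hankel_isHermitian hs n) ?_
      rw [conjTranspose_blockCol hs]
      exact ker_hankel_le_ker_blockRow h
    · rw [schurL, Matrix.mul_assoc]

theorem hankel_posSemidef_of_le {k : ℕ} (h : (hankel s n).PosSemidef) (hk : k ≤ n) :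
    (hankel s k).PosSemidef :=
  h.submatrix (Prod.map (Fin.castLE (Nat.succ_le_succ hk)) id)

theorem isHermitian_of_hankel_isHermitian (h : (hankel s n).IsHermitian) {j : ℕ}
    (hj : j ≤ 2 * n) : (s j).IsHermitian := by
  obtain ⟨a, b, rfl, ha, hb⟩ : ∃ a b, j = a + b ∧ a < n + 1 ∧ b < n + 1 :=
    ⟨j / 2, j - j / 2, by omega, by omega, by omega⟩
  ext i k
  simpa only [hankel, of_apply, conjTranspose_apply, add_comm b] using
    h.apply (⟨a, ha⟩, i) (⟨b, hb⟩, k)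

theorem ker_le_ker_of_hankel_posSemidef (h : (hankel s n).PosSemidef) {j : ℕ} (hj : j < 2 * n) :
    LinearMap.ker (s 0).mulVecLin ≤ LinearMap.ker (s j).mulVecLin := by
  have hcol : ∀ a i, a ≤ n → i ≤ n →
      LinearMap.ker (s (i + i)).mulVecLin ≤ LinearMap.ker (s (a + i)).mulVecLin := fun a i ha hi =>
    ker_submatrix_le_of_posSemidef h (Prod.mk ⟨i, Nat.lt_succ_of_le hi⟩)
      (Prod.mk ⟨a, Nat.lt_succ_of_le ha⟩)
  have heven : ∀ i < n, LinearMap.ker (s 0).mulVecLin ≤ LinearMap.ker (s (i + i)).mulVecLin := by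
    intro i hi
    induction i with
    | zero => exact le_rfl
    | succ i ih =>
      rw [show i + 1 + (i + 1) = i + 2 + i by ring]
      exact (ih (by omega)).trans (hcol (i + 2) i (by omega) (by omega))
  rcases Nat.even_or_odd' j with ⟨i, rfl | rfl⟩
  · rw [two_mul]
    exact heven i (by omega)
  · rw [show 2 * i + 1 = i + 1 + i by ring]
    exact (heven i (by omega)).trans (hcol (i + 1) i (by omega) (by omega))

end Hankel

section Transform

open PowerSeries

variable {q : ℕ} {s t : ℕ → Matrix (Fin q) (Fin q) ℂ} {A : Matrix (Fin q) (Fin q) ℂ}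

theorem mk_plusTransform (c : ℂ) (s : ℕ → Matrix (Fin q) (Fin q) ℂ) :
    mk (plusTransform c s) = mk s - X * (c • mk s) := by
  ext1 k
  cases k with
  | zero => simp [plusTransform]
  | succ k => simp [plusTransform, coeff_succ_X_mul, sub_eq_neg_add]

theorem mk_plusTransform_eq_add (c : ℂ) (s : ℕ → Matrix (Fin q) (Fin q) ℂ) :
    mk (plusTransform c s) = C (s 0) + X * mk (rightShift c s) := by
  ext1 k
  cases k with
  | zero => simp [plusTransform]
  | succ k => simp [plusTransform, rightShift, coeff_succ_X_mul, coeff_succ_C]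

theorem C_mul_mk_rightShift {E : Matrix (Fin q) (Fin q) ℂ} (c : ℂ) (h : C E * mk t = mk t) :
    C E * mk (rightShift c t) = mk (rightShift c t) := by
  have hE : ∀ j, E * t j = t j := fun j => by
    simpa only [coeff_C_mul, coeff_mk] using congrArg (coeff j) h
  ext1 j
  simp only [coeff_C_mul, coeff_mk, rightShift, mul_add, mul_neg, mul_smul_comm, hE]

theorem rightShift_isHermitian_iff {α : ℝ} {j : ℕ} (hj : (s j).IsHermitian) :
    (rightShift (α : ℂ) s j).IsHermitian ↔ (s (j + 1)).IsHermitian := by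
  have hα : ((α : ℂ) • s j).IsHermitian := hj.smul (Complex.conj_ofReal α)
  refine ⟨fun h => ?_, hα.neg.add⟩
  rw [← add_neg_cancel_left ((α : ℂ) • s j) (s (j + 1))]
  exact hα.add h

theorem isHermitian_of_plusTransform_isHermitian {α : ℝ}
    (h : ∀ j, (plusTransform (α : ℂ) s j).IsHermitian) (j : ℕ) : (s j).IsHermitian := by
  induction j with
  | zero => exact h 0
  | succ j ih => exact (rightShift_isHermitian_iff ih).1 (h (j + 1))

theorem invTransform_succ (c : ℂ) (t : ℕ → Matrix (Fin q) (Fin q) ℂ)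
    (A : Matrix (Fin q) (Fin q) ℂ) (j : ℕ) :
    invTransform c t A (j + 1) = c • invTransform c t A j + A * mpInv A *
      ∑ k ∈ Finset.range (j + 1), t (j - k) * mpInv A * plusTransform c (invTransform c t A) k := by
  have h : ∀ i, invTransform c t A i = c ^ i • A + ∑ l ∈ Finset.Icc 1 i, c ^ (i - l) •
      (A * mpInv A * ∑ k ∈ Finset.range l,
        t (l - k - 1) * mpInv A * plusTransform c (invTransform c t A) k) := by
    rintro (_ | i)
    · simp [invTransform_zero]
    · exact invTransform_eq c t A (i + 1) (by omega)
  have hsum : ∀ f : ℕ → Matrix (Fin q) (Fin q) ℂ, ∑ l ∈ Finset.Icc 1 (j + 1), c ^ (j + 1 - l) • f l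
      = c • ∑ l ∈ Finset.Icc 1 j, c ^ (j - l) • f l + f (j + 1) := fun f => by
    rw [Finset.sum_Icc_succ_top (by omega), Nat.sub_self, pow_zero, one_smul, Finset.smul_sum]
    congr 1
    refine Finset.sum_congr rfl fun l hl => ?_
    rw [smul_smul, ← pow_succ', ← Nat.sub_add_comm (Finset.mem_Icc.1 hl).2]
  rw [h (j + 1), h j, hsum, smul_add, smul_smul, ← pow_succ', add_assoc]
  simp only [Nat.sub_right_comm _ _ 1, Nat.add_sub_cancel]

theorem mk_plusTransform_invTransform (c : ℂ) (hE : C (A * mpInv A) * mk t = mk t) :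
    mk (plusTransform c (invTransform c t A)) =
      C A + X * (mk t * C (mpInv A) * mk (plusTransform c (invTransform c t A))) := by
  rw [← hE]
  ext1 k
  cases k with
  | zero => simp [plusTransform, invTransform_zero]
  | succ k =>
    rw [map_add, coeff_succ_C, zero_add, coeff_succ_X_mul, mul_assoc, mul_assoc, coeff_C_mul,
      ← mul_assoc (mk t), coeff_mk, plusTransform, invTransform_succ, neg_add_cancel_left,
      coeff_mul, ← Finset.Nat.sum_antidiagonal_swap,
      Finset.Nat.sum_antidiagonal_eq_sum_range_succ_mk]
    simp [coeff_mul_C]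

variable {α : ℝ} (hA : A.IsHermitian) (ht : ∀ j, (t j).IsHermitian)
  (hker : ∀ j, LinearMap.ker A.mulVecLin ≤ LinearMap.ker (t j).mulVecLin)

include hA ht hker

theorem C_mul_mpInv_mul_mk : C (A * mpInv A) * mk t = mk t := by
  ext1 j
  rw [coeff_C_mul, coeff_mk]
  exact mul_mpInv_mul_of_ker_le_conjTranspose hA (by rw [(ht j).eq]; exact hker j)

theorem mk_plusTransform_invTransform_right (c : ℂ) :
    mk (plusTransform c (invTransform c t A)) =
      C A + X * (mk (plusTransform c (invTransform c t A)) * C (mpInv A) * mk t) := by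
  have hE := C_mul_mpInv_mul_mk hA ht hker
  refine resolvent_right_of_left (mk_plusTransform_invTransform c hE) hE ?_
  ext1 j
  rw [coeff_mul_C, coeff_mk]
  exact mul_mpInv_mul_of_ker_le (hker j)

theorem plusTransform_invTransform_isHermitian (j : ℕ) :
    (plusTransform (α : ℂ) (invTransform (α : ℂ) t A) j).IsHermitian := by
  have hl := mk_plusTransform_invTransform (α : ℂ) (C_mul_mpInv_mul_mk hA ht hker)
  have hr := mk_plusTransform_invTransform_right hA ht hker (α : ℂ)
  have hT : ∀ k, IsSelfAdjoint (coeff k (mk t)) := fun k => by rw [coeff_mk]; exact ht k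
  have := isSelfAdjoint_coeff_of_resolvent hl hr hA (mpInv_isHermitian hA) hT j
  rwa [coeff_mk] at this

theorem invTransform_isHermitian (j : ℕ) : (invTransform (α : ℂ) t A j).IsHermitian :=
  isHermitian_of_plusTransform_isHermitian (plusTransform_invTransform_isHermitian hA ht hker) j

theorem schurL_rightShift_invTransform {n : ℕ} (hn : (hankel t n).PosSemidef) :
    schurL (rightShift (α : ℂ) (invTransform (α : ℂ) t A)) n = schurL t n := by
  have hs := invTransform_isHermitian (α := α) hA ht hker
  have hP := mk_plusTransform_eq_add (α : ℂ) (invTransform (α : ℂ) t A)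
  rw [invTransform_zero] at hP
  exact schurL_eq_of_hasPadeRemainder
    (fun j => (rightShift_isHermitian_iff (hs j)).2 (hs (j + 1)))
    ((hasPadeRemainder_schurL ht hn).of_resolvent <| resolvent_of_eq_C_add_X_mul hP
      (mk_plusTransform_invTransform_right hA ht hker _) (C_mul_mpInv_mul_mk hA ht hker))

theorem schurL_succ_invTransform {n : ℕ} (hn : (hankel (rightShift (α : ℂ) t) n).PosSemidef) :
    schurL (invTransform (α : ℂ) t A) (n + 1) = schurL (rightShift (α : ℂ) t) n := by
  have hτ : ∀ j, (rightShift (α : ℂ) t j).IsHermitian := fun j =>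
    (rightShift_isHermitian_iff (ht j)).2 (ht (j + 1))
  have hT : X * mk (rightShift (α : ℂ) t) = mk t - X * ((α : ℂ) • mk t) - C (t 0) := by
    rw [← mk_plusTransform, mk_plusTransform_eq_add, add_sub_cancel_left]
  have hP := mk_plusTransform_invTransform_right hA ht hker (α : ℂ)
  rw [mk_plusTransform] at hP
  exact schurL_eq_of_hasPadeRemainder (invTransform_isHermitian hA ht hker)
    ((hasPadeRemainder_schurL hτ hn).succ_of_resolvent
      (eq_of_sub_X_mul_resolvent hT hP)
      (C_mul_mk_rightShift (α : ℂ) (C_mul_mpInv_mul_mk hA ht hker)))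

end Transform

section Locality

variable {q : ℕ} {s s' : ℕ → Matrix (Fin q) (Fin q) ℂ}

theorem rightShift_congr (c : ℂ) {j : ℕ} (h : ∀ i ≤ j + 1, s i = s' i) :
    ∀ i ≤ j, rightShift c s i = rightShift c s' i := fun i hi => by
  rw [rightShift, rightShift, h i (by omega), h (i + 1) (by omega)]

theorem hankel_congr {n : ℕ} (h : ∀ i ≤ 2 * n, s i = s' i) : hankel s n = hankel s' n := by
  ext ⟨a, i⟩ ⟨b, j⟩
  simp only [hankel, Matrix.of_apply]
  rw [h _ (by omega)]

theorem blockRow_congr {l n : ℕ} (h : ∀ i ≤ l + n, s i = s' i) :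
    blockRow s l n = blockRow s' l n := by
  ext i ⟨a, j⟩
  simp only [blockRow, Matrix.of_apply]
  rw [h _ (by omega)]

theorem blockCol_congr {l n : ℕ} (h : ∀ i ≤ l + n, s i = s' i) :
    blockCol s l n = blockCol s' l n := by
  ext ⟨a, i⟩ j
  simp only [blockCol, Matrix.of_apply]
  rw [h _ (by omega)]

theorem schurL_congr {n : ℕ} (h : ∀ i ≤ 2 * n, s i = s' i) : schurL s n = schurL s' n := by
  cases n with
  | zero => exact h 0 le_rfl
  | succ n =>
    rw [schurL, schurL, h _ le_rfl, blockRow_congr fun i hi => h i (by omega),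
      blockCol_congr fun i hi => h i (by omega), hankel_congr fun i hi => h i (by omega)]

theorem stieltjesParam_congr (c : ℂ) {j : ℕ} (h : ∀ i ≤ j, s i = s' i) :
    stieltjesParam c s j = stieltjesParam c s' j := by
  rcases Nat.even_or_odd' j with ⟨k, rfl | rfl⟩
  · rw [stieltjesParam_even, stieltjesParam_even, schurL_congr h]
  · rw [stieltjesParam_odd, stieltjesParam_odd, schurL_congr (rightShift_congr c h)]

theorem plusTransform_congr (c : ℂ) {j : ℕ} (h : ∀ i ≤ j, s i = s' i) :
    plusTransform c s j = plusTransform c s' j := by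
  cases j with
  | zero => exact h 0 le_rfl
  | succ j => rw [plusTransform, plusTransform, h j (by omega), h (j + 1) le_rfl]

theorem invTransform_congr (c : ℂ) (A : Matrix (Fin q) (Fin q) ℂ) {j : ℕ}
    (h : ∀ i < j, s i = s' i) : invTransform c s A j = invTransform c s' A j := by
  induction j using Nat.strong_induction_on with
  | _ j ih =>
    cases j with
    | zero => rw [invTransform_zero, invTransform_zero]
    | succ j =>
      have hinv : ∀ k ≤ j, invTransform c s A k = invTransform c s' A k := fun k hk =>
        ih k (by omega) fun i hi => h i (by omega)
      rw [invTransform_succ, invTransform_succ, hinv j le_rfl]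
      congr 2
      refine Finset.sum_congr rfl fun k hk => ?_
      have hkj := Finset.mem_range.1 hk
      rw [h (j - k) (by omega), plusTransform_congr c fun i hi => hinv i (by omega)]

end Locality

section Stieltjes

open LinearMap (ker)

variable {q m : ℕ} {α : ℝ} {s s' t : ℕ → Matrix (Fin q) (Fin q) ℂ} {A : Matrix (Fin q) (Fin q) ℂ}

theorem IsStieltjesNonneg.congr (h : IsStieltjesNonneg α m s) (hs : ∀ i ≤ m, s i = s' i) :
    IsStieltjesNonneg α m s' := by
  refine ⟨?_, fun hm => ?_⟩
  · rw [← hankel_congr fun i hi => hs i (by omega)]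
    exact h.1
  · rw [← hankel_congr (rightShift_congr _ fun i hi => hs i (by omega))]
    exact h.2 hm

theorem IsStieltjesNonneg.of_le {k : ℕ} (h : IsStieltjesNonneg α m s) (hk : k ≤ m) :
    IsStieltjesNonneg α k s :=
  ⟨hankel_posSemidef_of_le h.1 (by omega),
    fun _ => hankel_posSemidef_of_le (h.2 (by omega)) (by omega)⟩

theorem IsStieltjesNonneg.isHermitian (h : IsStieltjesNonneg α m s) {j : ℕ} (hj : j ≤ m) :
    (s j).IsHermitian := by
  rcases le_or_gt j (2 * (m / 2)) with hj' | hj'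
  · exact isHermitian_of_hankel_isHermitian h.1.isHermitian hj'
  · obtain ⟨i, rfl⟩ : ∃ i, j = i + 1 := ⟨j - 1, by omega⟩
    have hi : (s i).IsHermitian := isHermitian_of_hankel_isHermitian h.1.isHermitian (by omega)
    rw [← rightShift_isHermitian_iff hi]
    exact isHermitian_of_hankel_isHermitian (h.2 (by omega)).isHermitian (by omega)

theorem le_ker_rightShift_iff {c : ℂ} {K : Submodule ℂ (Fin q → ℂ)} {j : ℕ}
    (hj : K ≤ ker (s j).mulVecLin) :
    K ≤ ker (rightShift c s j).mulVecLin ↔ K ≤ ker (s (j + 1)).mulVecLin := by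
  have hv : ∀ v ∈ K, (rightShift c s j).mulVecLin v = (s (j + 1)).mulVecLin v := fun v hv => by
    have hjv : (s j).mulVec v = 0 := hj hv
    simp only [rightShift, Matrix.mulVecLin_apply, Matrix.add_mulVec, Matrix.neg_mulVec,
      Matrix.smul_mulVec, hjv, smul_zero, neg_zero, zero_add]
  exact forall₂_congr fun v hvK => by rw [LinearMap.mem_ker, LinearMap.mem_ker, hv v hvK]

theorem IsStieltjesNonneg.ker_le_ker (h : IsStieltjesNonneg α m s) {j : ℕ} (hj : j < m) :
    ker (s 0).mulVecLin ≤ ker (s j).mulVecLin := by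
  rcases lt_or_ge j (2 * (m / 2)) with hj' | hj'
  · exact ker_le_ker_of_hankel_posSemidef h.1 hj'
  · rcases Nat.eq_zero_or_pos j with rfl | hpos
    · exact le_rfl
    · obtain ⟨i, rfl⟩ : ∃ i, j = i + 1 := ⟨j - 1, by omega⟩
      have h1 : ker (s 0).mulVecLin ≤ ker (s (0 + 1)).mulVecLin :=
        ker_le_ker_of_hankel_posSemidef h.1 (by omega)
      have hi : ker (s 0).mulVecLin ≤ ker (s i).mulVecLin :=
        ker_le_ker_of_hankel_posSemidef h.1 (by omega)
      rw [← le_ker_rightShift_iff (c := α) hi]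
      exact ((le_ker_rightShift_iff le_rfl).2 h1).trans
        (ker_le_ker_of_hankel_posSemidef (h.2 (by omega)) (by omega))

theorem IsStieltjesNonnegExt.exists_eqOn {κ : ℕ∞} (h : IsStieltjesNonnegExt α κ t) {j : ℕ}
    (hj : j ≤ κ) :
    ∃ s : ℕ → Matrix (Fin q) (Fin q) ℂ, IsStieltjesNonneg α (j + 1) s ∧ ∀ i ≤ j, s i = t i := by
  cases κ with
  | top => exact ⟨t, h (j + 1), fun _ _ => rfl⟩
  | coe m =>
    obtain ⟨Y, hY⟩ := h
    have hjm : j ≤ m := by exact_mod_cast hj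
    exact ⟨_, hY.of_le (by omega), fun i hi => Function.update_of_ne (by omega) _ _⟩

theorem IsStieltjesNonnegExt.isStieltjesNonneg {κ : ℕ∞} (h : IsStieltjesNonnegExt α κ t) {j : ℕ}
    (hj : j ≤ κ) : IsStieltjesNonneg α j t := by
  obtain ⟨s, hs, hst⟩ := h.exists_eqOn hj
  exact (hs.of_le j.le_succ).congr hst

theorem IsStieltjesNonnegExt.ker_le_ker {κ : ℕ∞} (h : IsStieltjesNonnegExt α κ t) {j : ℕ}
    (hj : j ≤ κ) : ker (t 0).mulVecLin ≤ ker (t j).mulVecLin := by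
  obtain ⟨s, hs, hst⟩ := h.exists_eqOn hj
  rw [← hst 0 j.zero_le, ← hst j le_rfl]
  exact hs.ker_le_ker j.lt_succ_self

theorem stieltjesParam_invTransform (hA : A.IsHermitian) (h : IsStieltjesNonneg α m t)
    (hker : ∀ i ≤ m, ker A.mulVecLin ≤ ker (t i).mulVecLin) :
    stieltjesParam (α : ℂ) (invTransform (α : ℂ) t A) (m + 1) = stieltjesParam (α : ℂ) t m := by
  wlog htrunc : ∀ i > m, t i = 0 generalizing t
  · set u : ℕ → Matrix (Fin q) (Fin q) ℂ := fun i => if i ≤ m then t i else 0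
    have hu : ∀ i ≤ m, t i = u i := fun i hi => (if_pos hi).symm
    rw [stieltjesParam_congr _ hu, stieltjesParam_congr _ fun i hi => invTransform_congr _ _
      fun k hk => hu k (by omega)]
    exact this (h.congr hu) (fun i hi => hu i hi ▸ hker i hi) fun i hi => if_neg hi.not_ge
  have ht : ∀ i, (t i).IsHermitian := fun i => by
    rcases le_or_gt i m with hi | hi
    · exact h.isHermitian hi
    · rw [htrunc i hi]
      exact Matrix.isHermitian_zero
  have hker' : ∀ i, ker A.mulVecLin ≤ ker (t i).mulVecLin := fun i => by
    rcases le_or_gt i m with hi | hi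
    · exact hker i hi
    · simp [htrunc i hi]
  rcases Nat.even_or_odd' m with ⟨k, rfl | rfl⟩
  · rw [stieltjesParam_even, stieltjesParam_odd]
    exact schurL_rightShift_invTransform hA ht hker' (hankel_posSemidef_of_le h.1 (by omega))
  · rw [stieltjesParam_odd, show 2 * k + 1 + 1 = 2 * (k + 1) by ring, stieltjesParam_even]
    exact schurL_succ_invTransform hA ht hker'
      (hankel_posSemidef_of_le (h.2 (by omega)) (by omega))

theorem stieltjesParam_invTransform_zero (c : ℂ) (t : ℕ → Matrix (Fin q) (Fin q) ℂ)
    (A : Matrix (Fin q) (Fin q) ℂ) : stieltjesParam c (invTransform c t A) 0 = A := by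
  rw [← mul_zero 2, stieltjesParam_even, schurL, invTransform_zero]

end Stieltjes

end StieltjesSchur

theorem theoremT0957_general (q : ℕ) (α : ℝ) (t : ℕ → Matrix (Fin q) (Fin q) ℂ)
    (A : Matrix (Fin q) (Fin q) ℂ) (hA : A.IsHermitian) :
    (∀ κ : ℕ∞, StieltjesSchur.IsStieltjesNonnegExt α κ t →
      LinearMap.ker A.mulVecLin ≤ LinearMap.ker (t 0).mulVecLin →
        StieltjesSchur.stieltjesParam (α : ℂ) (StieltjesSchur.invTransform (α : ℂ) t A) 0 = A ∧
        ∀ j : ℕ, 1 ≤ j → (j : ℕ∞) ≤ κ + 1 →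
          StieltjesSchur.stieltjesParam (α : ℂ) (StieltjesSchur.invTransform (α : ℂ) t A) j =
            StieltjesSchur.stieltjesParam (α : ℂ) t (j - 1)) ∧
    (∀ m : ℕ, StieltjesSchur.IsStieltjesNonneg α m t →
      LinearMap.ker A.mulVecLin ≤
        LinearMap.ker (t 0).mulVecLin ⊓ LinearMap.ker (t m).mulVecLin →
        StieltjesSchur.stieltjesParam (α : ℂ) (StieltjesSchur.invTransform (α : ℂ) t A) 0 = A ∧
        ∀ j : ℕ, 1 ≤ j → j ≤ m + 1 →
          StieltjesSchur.stieltjesParam (α : ℂ) (StieltjesSchur.invTransform (α : ℂ) t A) j =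
            StieltjesSchur.stieltjesParam (α : ℂ) t (j - 1)) := by
  have hQ0 := StieltjesSchur.stieltjesParam_invTransform_zero (α : ℂ) t A
  refine ⟨fun κ hκ hker => ⟨hQ0, fun j hj hjκ => ?_⟩, fun m hm hker => ⟨hQ0, fun j hj hjm => ?_⟩⟩
  · obtain ⟨i, rfl⟩ := Nat.exists_eq_add_of_le' hj
    have hi : (i : ℕ∞) ≤ κ := by
      rwa [Nat.cast_succ, ENat.add_le_add_iff_right ENat.one_ne_top] at hjκ
    have hle : ∀ k ≤ i, (k : ℕ∞) ≤ κ := fun k hk => (Nat.cast_le.2 hk).trans hi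
    exact StieltjesSchur.stieltjesParam_invTransform hA (hκ.isStieltjesNonneg hi)
      fun k hk => hker.trans (hκ.ker_le_ker (hle k hk))
  · obtain ⟨i, rfl⟩ := Nat.exists_eq_add_of_le' hj
    have hi : i ≤ m := Nat.le_of_succ_le_succ hjm
    refine StieltjesSchur.stieltjesParam_invTransform hA (hm.of_le hi) fun k hk => ?_
    rcases (hk.trans hi).lt_or_eq with hkm | rfl
    · exact (hker.trans inf_le_left).trans (hm.ker_le_ker hkm)
    · exact hker.trans inf_le_right

theorem theoremT0957 (q : ℕ) (α : ℝ) (t : ℕ → Matrix (Fin q) (Fin q) ℂ)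
    (A : Matrix (Fin q) (Fin q) ℂ) (hA : A.PosSemidef) :
    (∀ κ : ℕ∞, StieltjesSchur.IsStieltjesNonnegExt α κ t →
      LinearMap.ker A.mulVecLin ≤ LinearMap.ker (t 0).mulVecLin →
        StieltjesSchur.stieltjesParam (α : ℂ) (StieltjesSchur.invTransform (α : ℂ) t A) 0 = A ∧
        ∀ j : ℕ, 1 ≤ j → (j : ℕ∞) ≤ κ + 1 →
          StieltjesSchur.stieltjesParam (α : ℂ) (StieltjesSchur.invTransform (α : ℂ) t A) j =
            StieltjesSchur.stieltjesParam (α : ℂ) t (j - 1)) ∧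
    (∀ m : ℕ, StieltjesSchur.IsStieltjesNonneg α m t →
      LinearMap.ker A.mulVecLin ≤
        LinearMap.ker (t 0).mulVecLin ⊓ LinearMap.ker (t m).mulVecLin →
        StieltjesSchur.stieltjesParam (α : ℂ) (StieltjesSchur.invTransform (α : ℂ) t A) 0 = A ∧
        ∀ j : ℕ, 1 ≤ j → j ≤ m + 1 →
          StieltjesSchur.stieltjesParam (α : ℂ) (StieltjesSchur.invTransform (α : ℂ) t A) j =
            StieltjesSchur.stieltjesParam (α : ℂ) t (j - 1)) := by
  exact theoremT0957_general q α t A hA.isHermitian
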